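/- Let $R$ be a right noetherian ring (associative with unit, not necessarily commutative) and let $F$ be an indecomposable injective right $R$-module. A right $R$-module $M$ has $F$-rank $\kappa$, for a cardinal $\kappa$, if $M=M_1\oplus M_2$ where $M_1\cong F^{(\kappa)}$ (the direct sum of $\kappa$ copies of $F$) and $M_2$ has no direct summand isomorphic to $F$. Let $\mathbf C_F$ be the full subcategory of the category of right $R$-modules whose objects are the modules of finite $F$-rank. An ideal $\mathcal I$ of a preadditive category $\mathbf C$ consists of a subgroup $\mathcal I(X,Y)$ of $\operatorname{Hom}_{\mathbf C}(X,Y)$ for every pair of objects $X,Y$, such that $gif\in\mathcal I(X,Y)$ for all $f\in\operatorname{Hom}_{\mathbf C}(X,A)$, $i\in\mathcal I(A,B)$ and $g\in\operatorname{Hom}_{\mathbf C}(B,Y)$. It is proper if $\mathcal I\neq\operatorname{Hom}_{\mathbf C}$, and maximal if it is proper and not properly contained in any other proper ideal. Then the ring $\operatorname{End}_R(F)$ has exactly one maximal two-sided ideal $I$, and the ideal $\mathcal A_I$ of $\mathbf C_F$ given by $$\mathcal A_I(X,Y)=\{f\in\operatorname{Hom}_R(X,Y) : \beta f\alpha\in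 I \text{ for all } \alpha\in\operatorname{Hom}_R(F,X),\ \beta\in\operatorname{Hom}_R(Y,F)\}$$ is a maximal ideal of $\mathbf C_F$, and is the only maximal ideal of $\mathbf C_F$. -/

import Mathlib

open CategoryTheory

universe u v w

/-- An ideal of a preadditive category `C`: a subgroup of each hom-group, stable under composition
with arbitrary morphisms on both sides (an additive subfunctor of the bifunctor `Hom`). -/
@[ext]
structure CategoryIdeal (C : Type u) [Category.{v} C] [Preadditive C] where
  hom : ∀ X Y : C, AddSubgroup (X ⟶ Y)
  comp_mem : ∀ {X A B Y : C} (f : X ⟶ A) {i : A ⟶ B} (g : B ⟶ Y),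
    i ∈ hom A B → f ≫ i ≫ g ∈ hom X Y

namespace CategoryIdeal

section

variable {C : Type u} [Category.{v} C] [Preadditive C]

/-- Ideals are ordered by inclusion, so that a maximal ideal is a coatom: an ideal different from
the whole of `Hom` and not properly contained in any other such ideal. -/
instance : PartialOrder (CategoryIdeal C) where
  le I J := ∀ X Y : C, I.hom X Y ≤ J.hom X Y
  le_refl _ _ _ := le_rfl
  le_trans _ _ _ h h' X Y := (h X Y).trans (h' X Y)
  le_antisymm _ _ h h' := CategoryIdeal.ext
    (funext fun X => funext fun Y => le_antisymm (h X Y) (h' X Y))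

/-- The greatest ideal is the whole of `Hom`. -/
instance : OrderTop (CategoryIdeal C) where
  top :=
    { hom := fun _ _ => ⊤
      comp_mem := fun _ _ _ _ => AddSubgroup.mem_top _ }
  le_top _ _ _ := le_top

/-- The ideal of `C` associated to a two-sided ideal `I` of `End A`: the morphisms `f : X ⟶ Y` such
that `β f α ∈ I` for all `α : A ⟶ X` and `β : Y ⟶ A`. -/
def associated (A : C) (I : TwoSidedIdeal (End A)) : CategoryIdeal C where
  hom X Y :=
    { carrier := {f | ∀ (α : A ⟶ X) (β : Y ⟶ A), (show End A from α ≫ f ≫ β) ∈ I}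
      zero_mem' := fun α β => by
        have h : (show End A from α ≫ (0 : X ⟶ Y) ≫ β) = 0 := by simp
        rw [h]
        exact I.zero_mem
      add_mem' := fun {f g} hf hg α β => by
        have h : (show End A from α ≫ (f + g) ≫ β) =
            (show End A from α ≫ f ≫ β) + (show End A from α ≫ g ≫ β) := by simp
        rw [h]
        exact I.add_mem (hf α β) (hg α β)
      neg_mem' := fun {f} hf α β => by
        have h : (show End A from α ≫ (-f) ≫ β) = -(show End A from α ≫ f ≫ β) := by simp
        rw [h]
        exact I.neg_mem (hf α β) }
  comp_mem {X P Q Y} f {i} g hi α β := by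
    have h : (show End A from α ≫ (f ≫ i ≫ g) ≫ β) =
        (show End A from (α ≫ f) ≫ i ≫ (g ≫ β)) := by simp
    rw [h]
    exact hi _ _

/-- The restriction of an ideal of `C` to the full subcategory of the objects satisfying `P`. -/
def restrict (I : CategoryIdeal C) (P : ObjectProperty C) : CategoryIdeal P.FullSubcategory where
  hom X Y :=
    { carrier := {f | f.hom ∈ I.hom X.obj Y.obj}
      zero_mem' := (I.hom X.obj Y.obj).zero_mem
      add_mem' := fun hf hg => (I.hom X.obj Y.obj).add_mem hf hg
      neg_mem' := fun hf => (I.hom X.obj Y.obj).neg_mem hf }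
  comp_mem f _ g hi := I.comp_mem f.hom g.hom hi

end

end CategoryIdeal

/-- `HasFRank S F M κ` : the module `M` has `F`-rank `κ`, that is, `M = M₁ ⊕ M₂` where `M₁` is
isomorphic to a direct sum of `κ` copies of `F` and no direct summand of `M₂` is isomorphic
to `F`. -/
def HasFRank (S : Type u) [Ring S] (F : Type v) [AddCommGroup F] [Module S F]
    (M : Type w) [AddCommGroup M] [Module S M] (κ : Cardinal.{w}) : Prop :=
  ∃ M₁ M₂ : Submodule S M, IsCompl M₁ M₂ ∧
    (∃ Γ : Type w, Cardinal.mk Γ = κ ∧ Nonempty (M₁ ≃ₗ[S] (Γ →₀ F))) ∧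
    ¬ ∃ N N' : Submodule S M₂, IsCompl N N' ∧ Nonempty (N ≃ₗ[S] F)

/-- The modules of finite `F`-rank, that is, the objects of the category `C_F`. -/
def finiteFRank {S : Type u} [Ring S] (F : ModuleCat.{v} S) : ObjectProperty (ModuleCat.{v} S) :=
  fun M => ∃ κ : Cardinal.{v}, κ < Cardinal.aleph0 ∧ HasFRank S F M κ

/-!
An indecomposable injective module `F` is uniform: if two nonzero submodules were disjoint,
enlarging them to a maximal disjoint pair would give a nontrivial decomposition of `F`
(`Module.Injective.isCompl_of_maximal_disjoint`). So an endomorphism of `F` is a unit exactly when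
its kernel is zero, the nonunits are closed under addition, and `End F` is local. Its two-sided
ideal `I` of nonunits contains every proper two-sided ideal, and is thus the only maximal one.

Let `𝒜` be the ideal of `C_F` associated to `I`. An ideal `J` not contained in `𝒜` contains `𝟙 F`
(`CategoryIdeal.id_mem_of_not_le`). A module without direct summands isomorphic to `F` has its
identity in `𝒜`, and the identity of a module of finite `F`-rank is a finite sum of maps through `F`
plus a map through such a module. Hence an ideal strictly larger than `𝒜` is everything, and `𝒜` is
maximal.

For the uniqueness, it has to be excluded that a maximal ideal `J` contains `𝟙 F`. By the same
decomposition, it is enough that `J` contains `𝟙 A` for each `A` without direct summands isomorphic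
to `F`. By uniformity of `F`, every power `A^(Γ)` is again without such summands
(`Module.Injective.exists_retract_of_finsupp`), so it belongs to `C_F`. If `𝟙 A` were not in `J`,
then `J` together with the ideal of homomorphisms of range of cardinality at most `max ℵ₀ #A`, which
contains `𝟙 A`, would be everything. For `Γ` of larger cardinality this decomposes the identity of
`A^(Γ)`, and looking at a coordinate that the homomorphism of small range misses puts `𝟙 A` into `J`
after all (`CategoryIdeal.id_mem_of_isCoatom`).
-/

/-! ### Indecomposable injective modules -/

section InjectiveModule

/-- An element disjoint from `a` lies below a maximal element disjoint from `a`. -/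
theorem exists_maximal_disjoint {α : Type*} [CompleteLattice α] [IsCompactlyGenerated α]
    {a b : α} (h : Disjoint b a) :
    ∃ c, b ≤ c ∧ Disjoint c a ∧ ∀ d, c ≤ d → Disjoint d a → d = c := by
  obtain ⟨c, hbc, hc⟩ := zorn_le_nonempty₀ {d : α | Disjoint d a}
    (fun s hs hchain _ _ => ⟨sSup s, hchain.directedOn.disjoint_sSup_left.2 fun d hd => hs hd,
      fun d hd => le_sSup hd⟩) b h
  exact ⟨c, hbc, hc.1, fun d hcd hd => (hc.eq_of_le hd hcd).symm⟩

variable {S : Type u} [Ring S] {F : Type v} [AddCommGroup F] [Module S F]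
  {M : Type w} [AddCommGroup M] [Module S M]

theorem LinearMap.isCompl_range_ker_of_leftInverse {i : F →ₗ[S] M} {p : M →ₗ[S] F}
    (h : p ∘ₗ i = LinearMap.id) : IsCompl (LinearMap.range i) (LinearMap.ker p) := by
  have hpi : ∀ x, p (i x) = x := fun x => LinearMap.congr_fun h x
  refine ⟨Submodule.disjoint_def.2 ?_, codisjoint_iff_le_sup.2 fun x _ => ?_⟩
  · rintro _ ⟨y, rfl⟩ hy
    rw [LinearMap.mem_ker, hpi] at hy
    rw [hy, map_zero]
  · refine Submodule.mem_sup.2 ⟨i (p x), ⟨_, rfl⟩, x - i (p x), ?_, add_sub_cancel _ _⟩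
    rw [LinearMap.mem_ker, map_sub, hpi, sub_self]

variable {N : Type v} [AddCommGroup N] [Module S N] [Module.Injective S F]

theorem Module.Injective.exists_retraction {f : F →ₗ[S] N} (hf : Function.Injective f) :
    ∃ g : N →ₗ[S] F, g ∘ₗ f = LinearMap.id := by
  obtain ⟨g, hg⟩ := Module.Injective.out f hf (LinearMap.id : F →ₗ[S] F)
  exact ⟨g, LinearMap.ext hg⟩

/-- Two submodules of an injective module which are maximal among the submodules disjoint from
each other are complements. -/
theorem Module.Injective.isCompl_of_maximal_disjoint {C D : Submodule S F} (hCD : Disjoint D C)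
    (hC : ∀ Q, C ≤ Q → Disjoint Q D → Q = C) (hD : ∀ Q, D ≤ Q → Disjoint Q C → Q = D) :
    IsCompl D C := by
  have hj : Function.Injective (C.mkQ ∘ₗ D.subtype) := by
    rw [← LinearMap.ker_eq_bot, LinearMap.ker_comp, Submodule.ker_mkQ]
    exact Submodule.disjoint_iff_comap_eq_bot.1 hCD
  -- Extending the inclusion of `D` along the embedding `D → F ⧸ C` gives an endomorphism of `F`
  -- that vanishes on `C` and is the identity on `D`.
  obtain ⟨h, hh⟩ := Module.Injective.out (C.mkQ ∘ₗ D.subtype) hj D.subtype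
  let φ : F →ₗ[S] F := h ∘ₗ C.mkQ
  have hφD : ∀ x ∈ D, φ x = x := fun x hx => hh ⟨x, hx⟩
  have hφC : ∀ x ∈ C, φ x = 0 := fun x hx => by
    simp [φ, (Submodule.Quotient.mk_eq_zero C).2 hx]
  have hdisj : Disjoint (C.comap φ) D := by
    refine Submodule.disjoint_def.2 fun x hx hxD => ?_
    rw [Submodule.mem_comap, hφD x hxD] at hx
    exact Submodule.disjoint_def.1 hCD x hxD hx
  have hcomap : C.comap φ = C := hC _ (fun x hx => by
    rw [Submodule.mem_comap, hφC x hx]; exact C.zero_mem) hdisj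
  have hrange : LinearMap.range φ = D := by
    refine hD _ (fun x hx => ⟨x, hφD x hx⟩) (Submodule.disjoint_def.2 ?_)
    rintro _ ⟨x, rfl⟩ hx
    exact hφC x (hcomap ▸ (Submodule.mem_comap.2 hx))
  refine ⟨hCD, codisjoint_iff_le_sup.2 fun x _ => ?_⟩
  have hx : φ x ∈ D := hrange ▸ ⟨x, rfl⟩
  refine Submodule.mem_sup.2 ⟨φ x, hx, x - φ x, ?_, add_sub_cancel _ _⟩
  rw [← hcomap, Submodule.mem_comap, map_sub, hφD _ hx, sub_self]
  exact C.zero_mem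

/-- An indecomposable injective module is uniform: nonzero submodules are never disjoint. -/
theorem Module.Injective.eq_bot_or_eq_bot_of_disjoint
    (hF : ∀ C D : Submodule S F, IsCompl C D → C = ⊥ ∨ D = ⊥) {A B : Submodule S F}
    (h : Disjoint A B) : A = ⊥ ∨ B = ⊥ := by
  obtain ⟨C, hBC, hCA, hC⟩ := exists_maximal_disjoint h.symm
  obtain ⟨D, hAD, hDC, hD⟩ := exists_maximal_disjoint hCA.symm
  rcases hF D C (isCompl_of_maximal_disjoint hDC
    (fun Q hCQ hQ => hC Q hCQ (hQ.mono_right hAD)) hD) with rfl | rfl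
  · exact .inl (le_bot_iff.1 hAD)
  · exact .inr (le_bot_iff.1 hBC)

theorem Module.Injective.isUnit_of_injective [Nontrivial F]
    (hF : ∀ C D : Submodule S F, IsCompl C D → C = ⊥ ∨ D = ⊥) {f : Module.End S F}
    (hf : Function.Injective f) : IsUnit f := by
  obtain ⟨g, hg⟩ := exists_retraction hf
  have hc := LinearMap.isCompl_range_ker_of_leftInverse hg
  rcases hF _ _ hc with h | h
  · have hbot : (⊥ : Submodule S F) = ⊤ := by
      rw [← LinearMap.ker_eq_bot.2 hf, LinearMap.range_eq_bot.1 h, LinearMap.ker_zero]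
    exact absurd hbot bot_ne_top
  · rw [h] at hc
    exact (Module.End.isUnit_iff f).2
      ⟨hf, LinearMap.range_eq_top.1 (by simpa using hc.sup_eq_top)⟩

theorem Module.Injective.isLocalRing_end [Nontrivial F]
    (hF : ∀ C D : Submodule S F, IsCompl C D → C = ⊥ ∨ D = ⊥) :
    IsLocalRing (Module.End S F) := by
  refine IsLocalRing.of_nonunits_add fun f g hf hg hfg => ?_
  -- The kernels of two nonunits are nonzero, so they meet in a nonzero submodule of `ker (f + g)`.
  have hdisj : Disjoint (LinearMap.ker f) (LinearMap.ker g) := by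
    refine Submodule.disjoint_def.2 fun x hxf hxg => ?_
    refine ((Module.End.isUnit_iff _).1 hfg).1 ?_
    rw [map_zero, LinearMap.add_apply, LinearMap.mem_ker.1 hxf, LinearMap.mem_ker.1 hxg, add_zero]
  rcases eq_bot_or_eq_bot_of_disjoint hF hdisj with h | h
  · exact hf (isUnit_of_injective hF (LinearMap.ker_eq_bot.1 h))
  · exact hg (isUnit_of_injective hF (LinearMap.ker_eq_bot.1 h))

/-- An indecomposable injective module that is a retract of a direct sum of copies of `N` is a
retract of `N`. A nonzero element of `F` lies in the sum of finitely many copies, so by uniformity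
one of the finitely many projections concerned is injective on `F`. -/
theorem Module.Injective.exists_retract_of_finsupp [Nontrivial F]
    (hF : ∀ C D : Submodule S F, IsCompl C D → C = ⊥ ∨ D = ⊥) {Γ : Type*}
    {i : F →ₗ[S] (Γ →₀ N)} (hi : Function.Injective i) :
    ∃ (j : F →ₗ[S] N) (q : N →ₗ[S] F), q ∘ₗ j = LinearMap.id := by
  classical
  obtain ⟨x, hx⟩ := exists_ne (0 : F)
  have key : ∀ s : Finset Γ, (∀ γ ∈ s, LinearMap.ker (Finsupp.lapply γ ∘ₗ i) ≠ ⊥) →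
      s.inf (fun γ => LinearMap.ker (Finsupp.lapply γ ∘ₗ i)) ≠ ⊥ := by
    intro s
    induction s using Finset.induction_on with
    | empty => simp
    | insert γ s _ ih =>
      intro h hbot
      rw [Finset.inf_insert, ← disjoint_iff] at hbot
      rcases eq_bot_or_eq_bot_of_disjoint hF hbot with h' | h'
      · exact h γ (Finset.mem_insert_self γ s) h'
      · exact ih (fun δ hδ => h δ (Finset.mem_insert_of_mem hδ)) h'
  have hdisj : Disjoint (Submodule.span S {x})
      ((i x).support.inf fun γ => LinearMap.ker (Finsupp.lapply γ ∘ₗ i)) := by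
    refine Submodule.disjoint_def.2 fun y hy hyk => ?_
    obtain ⟨r, rfl⟩ := Submodule.mem_span_singleton.1 hy
    refine hi (Finsupp.ext fun γ => ?_)
    by_cases hγ : γ ∈ (i x).support
    · simpa using
        Finset.inf_le (f := fun γ => LinearMap.ker (Finsupp.lapply γ ∘ₗ i)) hγ hyk
    · simp [Finsupp.notMem_support_iff.1 hγ]
  rcases eq_bot_or_eq_bot_of_disjoint hF hdisj with h | h
  · exact absurd (Submodule.span_singleton_eq_bot.1 h) hx
  · by_contra hno
    refine key _ (fun γ _ hγ => hno ?_) h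
    obtain ⟨q, hq⟩ := exists_retraction (LinearMap.ker_eq_bot.1 hγ)
    exact ⟨_, q, hq⟩

end InjectiveModule

/-! ### Local rings -/

namespace IsLocalRing

variable {A : Type u} [Ring A] [IsLocalRing A]

theorem mul_eq_one_symm {a b : A} (h : a * b = 1) : b * a = 1 := by
  have hidem : b * a * (b * a) = b * a := by rw [mul_assoc, ← mul_assoc a, h, one_mul]
  rcases isUnit_or_isUnit_of_add_one (add_sub_cancel (b * a) 1) with hu | hu
  · exact hu.mul_left_cancel (by rw [hidem, mul_one])
  · have h0 : b * a = 0 := hu.mul_left_cancel (by rw [sub_mul, one_mul, hidem, sub_self, mul_zero])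
    have h1 : (1 : A) = a * (b * a) * b := by rw [← mul_assoc, h, one_mul, h]
    rw [h0, mul_zero, zero_mul] at h1
    exact absurd h1 one_ne_zero

theorem isUnit_of_mul_eq_one {a b : A} (h : a * b = 1) : IsUnit a :=
  ⟨⟨a, b, h, mul_eq_one_symm h⟩, rfl⟩

theorem isUnit_of_mul_eq_one' {a b : A} (h : a * b = 1) : IsUnit b :=
  ⟨⟨b, a, mul_eq_one_symm h, h⟩, rfl⟩

variable (A) in
/-- The nonunits of a local ring, as a two-sided ideal. -/
def nonunitsIdeal : TwoSidedIdeal A :=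
  .mk' (nonunits A) (by simp) nonunits_add
    (fun {x} hx h => hx (by simpa using h.neg))
    (fun {x y} hy h => hy (by
      obtain ⟨u, hu⟩ := h.exists_left_inv
      exact isUnit_of_mul_eq_one' (by rwa [← mul_assoc] at hu)))
    (fun {x y} hx h => hx (by
      obtain ⟨u, hu⟩ := h.exists_right_inv
      exact isUnit_of_mul_eq_one (by rwa [mul_assoc] at hu)))

theorem mem_nonunitsIdeal {a : A} : a ∈ nonunitsIdeal A ↔ ¬ IsUnit a :=
  TwoSidedIdeal.mem_mk' ..

theorem nonunitsIdeal_ne_top : nonunitsIdeal A ≠ ⊤ := fun h =>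
  mem_nonunitsIdeal.1 (h ▸ TwoSidedIdeal.mem_top A : (1 : A) ∈ nonunitsIdeal A) isUnit_one

theorem le_nonunitsIdeal {I : TwoSidedIdeal A} (hI : I ≠ ⊤) : I ≤ nonunitsIdeal A := by
  intro a ha
  refine mem_nonunitsIdeal.2 fun hu => hI ((TwoSidedIdeal.one_mem_iff I).1 ?_)
  obtain ⟨b, hb⟩ := hu.exists_left_inv
  exact hb ▸ I.mul_mem_left b a ha

theorem isCoatom_twoSidedIdeal_iff {I : TwoSidedIdeal A} :
    IsCoatom I ↔ I = nonunitsIdeal A := by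
  constructor
  · exact fun h => ((h.le_iff_eq nonunitsIdeal_ne_top).1 (le_nonunitsIdeal h.1)).symm
  · rintro rfl
    exact ⟨nonunitsIdeal_ne_top, fun J hJ => by_contra fun h => hJ.not_ge (le_nonunitsIdeal h)⟩

end IsLocalRing

/-! ### Modules of finite `F`-rank -/

section FRank

variable {S : Type u} [Ring S] {F : Type v} [AddCommGroup F] [Module S F]
  {M : Type w} [AddCommGroup M] [Module S M]

theorem Submodule.exists_isCompl_linearEquiv_iff :
    (∃ N N' : Submodule S M, IsCompl N N' ∧ Nonempty (N ≃ₗ[S] F)) ↔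
      ∃ (i : F →ₗ[S] M) (p : M →ₗ[S] F), p ∘ₗ i = LinearMap.id := by
  constructor
  · rintro ⟨N, N', h, ⟨e⟩⟩
    refine ⟨N.subtype ∘ₗ e.symm.toLinearMap,
      e.toLinearMap ∘ₗ LinearMap.fst S N N' ∘ₗ (N.prodEquivOfIsCompl N' h).symm.toLinearMap, ?_⟩
    ext x
    simp
  · rintro ⟨i, p, h⟩
    have hi : Function.Injective i :=
      Function.LeftInverse.injective (g := p) fun x => LinearMap.congr_fun h x
    exact ⟨_, _, LinearMap.isCompl_range_ker_of_leftInverse h,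
      ⟨(LinearEquiv.ofInjective i hi).symm⟩⟩

theorem hasFRank_zero (h : ¬ ∃ (i : F →ₗ[S] M) (p : M →ₗ[S] F), p ∘ₗ i = LinearMap.id) :
    HasFRank S F M 0 := by
  refine ⟨⊥, ⊤, isCompl_bot_top, ⟨PEmpty, Cardinal.mk_pempty, ⟨0, 0, ?_, ?_⟩⟩, fun h' => h ?_⟩
  · intro x
    exact Subsingleton.elim _ _
  · intro x
    exact Subsingleton.elim _ _
  · obtain ⟨i, p, hip⟩ := Submodule.exists_isCompl_linearEquiv_iff.1 h'
    refine ⟨Submodule.subtype ⊤ ∘ₗ i, p ∘ₗ Submodule.topEquiv.symm.toLinearMap, ?_⟩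
    rw [← hip]
    rfl

theorem hasFRank_self [Nontrivial F] : HasFRank S F F 1 := by
  refine ⟨⊤, ⊥, isCompl_top_bot, ⟨PUnit, Cardinal.mk_punit,
    ⟨Submodule.topEquiv.trans (Finsupp.uniqueLinearEquiv S F PUnit.unit).symm⟩⟩, ?_⟩
  rintro ⟨N, N', -, ⟨e⟩⟩
  exact not_subsingleton F e.symm.toEquiv.subsingleton

/-- The identity of a module of finite `F`-rank is a finite sum of maps that factor through `F`, up
to a map that factors through a module without direct summands isomorphic to `F`. -/
theorem HasFRank.exists_decomposition {κ : Cardinal.{w}} (h : HasFRank S F M κ)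
    (hκ : κ < Cardinal.aleph0) :
    ∃ (Γ : Type w) (_ : Fintype Γ) (f : Γ → M →ₗ[S] F) (g : Γ → F →ₗ[S] M) (N : Submodule S M)
      (p : M →ₗ[S] N), (∑ γ, g γ ∘ₗ f γ) + N.subtype ∘ₗ p = LinearMap.id ∧
        ¬ ∃ (i : F →ₗ[S] N) (q : N →ₗ[S] F), q ∘ₗ i = LinearMap.id := by
  classical
  obtain ⟨M₁, M₂, hc, ⟨Γ, rfl, ⟨e⟩⟩, hM₂⟩ := h
  rw [Submodule.exists_isCompl_linearEquiv_iff] at hM₂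
  have : Fintype Γ := @Fintype.ofFinite Γ (Cardinal.lt_aleph0_iff_finite.1 hκ)
  let s := (M₁.prodEquivOfIsCompl M₂ hc).symm.toLinearMap
  refine ⟨Γ, this, fun γ => Finsupp.lapply γ ∘ₗ e.toLinearMap ∘ₗ LinearMap.fst S M₁ M₂ ∘ₗ s,
    fun γ => M₁.subtype ∘ₗ e.symm.toLinearMap ∘ₗ Finsupp.lsingle γ, M₂,
    LinearMap.snd S M₁ M₂ ∘ₗ s, LinearMap.ext fun x => ?_, hM₂⟩
  have hx : ((s x).1 : M) + (s x).2 = x :=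
    (M₁.prodEquivOfIsCompl M₂ hc).apply_symm_apply x
  have hsum : (∑ γ, ((e.symm (Finsupp.single γ (e (s x).1 γ)) : M₁) : M)) = (s x).1 := by
    rw [← Submodule.coe_sum, ← map_sum, Finsupp.univ_sum_single, e.symm_apply_apply]
  simpa [hsum] using hx

end FRank

/-! ### Ideals of full subcategories of modules -/

namespace CategoryIdeal

section

variable {C : Type u} [Category.{v} C] [Preadditive C]

/-- The sum of two ideals. -/
def sum (I J : CategoryIdeal C) : CategoryIdeal C where
  hom X Y := I.hom X Y ⊔ J.hom X Y
  comp_mem {X A B Y} f i g hi := by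
    obtain ⟨a, ha, b, hb, rfl⟩ := AddSubgroup.mem_sup.1 hi
    rw [Preadditive.add_comp, Preadditive.comp_add]
    exact AddSubgroup.mem_sup.2 ⟨_, I.comp_mem f g ha, _, J.comp_mem f g hb, rfl⟩

theorem le_sum_left (I J : CategoryIdeal C) : I ≤ I.sum J := fun _ _ => le_sup_left

theorem le_sum_right (I J : CategoryIdeal C) : J ≤ I.sum J := fun _ _ => le_sup_right

theorem mem_of_id_mem {I : CategoryIdeal C} {A X Y : C} (h : 𝟙 A ∈ I.hom A A) (f : X ⟶ A)
    (g : A ⟶ Y) : f ≫ g ∈ I.hom X Y := by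
  simpa using I.comp_mem f g h

theorem eq_top_of_id_mem {I : CategoryIdeal C} (h : ∀ X, 𝟙 X ∈ I.hom X X) : I = ⊤ :=
  top_le_iff.1 fun X _ f _ => by simpa using mem_of_id_mem (h X) (𝟙 X) f

end

variable {S : Type u} [Ring S]

/-- The ideal of the homomorphisms whose range has cardinality at most `c`, in a full subcategory
of the category of modules. -/
def smallRange (P : ObjectProperty (ModuleCat.{v} S)) (c : Cardinal.{v})
    (hc : Cardinal.aleph0 ≤ c) : CategoryIdeal P.FullSubcategory where
  hom X Y :=
    { carrier := {f | Cardinal.mk (Set.range f.hom.hom) ≤ c}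
      zero_mem' := by
        refine le_trans (Cardinal.mk_le_one_iff_set_subsingleton.2 ?_)
          (Cardinal.one_le_aleph0.trans hc)
        rintro _ ⟨x, rfl⟩ _ ⟨y, rfl⟩
        rfl
      add_mem' := fun {f g} hf hg => by
        have hsub : Set.range (f + g).hom.hom ⊆
            Set.image2 (· + ·) (Set.range f.hom.hom) (Set.range g.hom.hom) := by
          rintro _ ⟨x, rfl⟩
          exact ⟨_, ⟨x, rfl⟩, _, ⟨x, rfl⟩, rfl⟩
        rw [← Set.image_uncurry_prod] at hsub
        refine (Cardinal.mk_le_mk_of_subset hsub).trans (Cardinal.mk_image_le.trans ?_)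
        rw [Cardinal.mk_setProd, ← Cardinal.mul_eq_self hc]
        simpa using mul_le_mul' hf hg
      neg_mem' := fun {f} hf => by
        have h : Set.range (-f).hom.hom = (fun y => -y) '' Set.range f.hom.hom := by
          rw [← Set.range_comp]
          rfl
        rw [Set.mem_ofPred_eq, h]
        exact Cardinal.mk_image_le.trans hf }
  comp_mem {X A B Y} f i g hi := by
    have hsub : Set.range (f ≫ i ≫ g).hom.hom ⊆ g.hom.hom '' Set.range i.hom.hom := by
      rintro _ ⟨x, rfl⟩
      exact ⟨_, ⟨f.hom.hom x, rfl⟩, rfl⟩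
    exact (Cardinal.mk_le_mk_of_subset hsub).trans (Cardinal.mk_image_le.trans hi)

/-- A maximal ideal contains the identity of any object all of whose powers `Γ →₀ A` belong to the
category. Otherwise let `c` be the larger of `ℵ₀` and `#A`. The ideal and the homomorphisms of range
of cardinality at most `c` together generate everything, so the identity of a power with `c < #Γ` is
a sum `m + k` with `m` in the ideal and the range of `k` of cardinality at most `c`. Such a `k`
vanishes in one of the coordinates, so that `m` induces the identity on that copy of `A`. -/
theorem id_mem_of_isCoatom {P : ObjectProperty (ModuleCat.{v} S)}
    {I : CategoryIdeal P.FullSubcategory} (hI : IsCoatom I) (A : P.FullSubcategory)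
    (hA : ∀ Γ : Type v, P (ModuleCat.of S (Γ →₀ A.obj))) : 𝟙 A ∈ I.hom A A := by
  by_contra hid
  let c : Cardinal.{v} := max Cardinal.aleph0 (Cardinal.mk A.obj)
  have hc : Cardinal.aleph0 ≤ c := le_max_left _ _
  have htop : I.sum (smallRange P c hc) = ⊤ := by
    refine hI.2 _ (lt_of_le_of_ne (le_sum_left _ _) fun h => hid ?_)
    rw [h]
    exact le_sum_right _ _ A A (Cardinal.mk_set_le _ |>.trans (le_max_right _ _) :
      Cardinal.mk (Set.range (𝟙 A : A ⟶ A).hom.hom) ≤ c)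
  let Γ : Type v := (Order.succ c).out
  have hΓ : c < Cardinal.mk Γ := by
    rw [Cardinal.mk_out]
    exact Order.lt_succ c
  let B : P.FullSubcategory := ⟨ModuleCat.of S (Γ →₀ A.obj), hA Γ⟩
  have hB : 𝟙 B ∈ (I.sum (smallRange P c hc)).hom B B := by
    rw [htop]
    exact AddSubgroup.mem_top _
  obtain ⟨m, hm, k, hk, hmk⟩ := AddSubgroup.mem_sup.1 hB
  obtain ⟨γ, hγ⟩ : ∃ γ : Γ, ∀ y ∈ Set.range k.hom.hom, (show Γ →₀ A.obj from y) γ = 0 := by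
    by_contra! hall
    have hcover : (Set.univ : Set Γ) ⊆ ⋃ y : Set.range k.hom.hom,
        (((show Γ →₀ A.obj from y.1).support : Finset Γ) : Set Γ) := by
      intro γ _
      obtain ⟨y, hy, hyγ⟩ := hall γ
      exact Set.mem_iUnion.2 ⟨⟨y, hy⟩, Finset.mem_coe.2 (Finsupp.mem_support_iff.2 hyγ)⟩
    refine hΓ.not_ge ?_
    rw [← Cardinal.mk_univ]
    refine (Cardinal.mk_le_mk_of_subset hcover).trans ((Cardinal.mk_iUnion_le _).trans ?_)
    rw [← Cardinal.mul_eq_self hc]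
    refine mul_le_mul' hk (ciSup_le' fun y => ?_)
    exact (Cardinal.lt_aleph0_of_finite _).le.trans hc
  let i : A ⟶ B := ObjectProperty.homMk (ModuleCat.ofHom (Finsupp.lsingle γ))
  let p : B ⟶ A := ObjectProperty.homMk (ModuleCat.ofHom (Finsupp.lapply γ))
  have hip : i ≫ p = 𝟙 A := by
    ext x
    exact Finsupp.single_eq_same
  have hikp : i ≫ k ≫ p = 0 := by
    ext x
    exact hγ _ ⟨_, rfl⟩
  have himp : i ≫ m ≫ p = 𝟙 A := by
    rw [← add_zero (i ≫ m ≫ p), ← hikp, ← Preadditive.comp_add, ← Preadditive.add_comp, hmk,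
      Category.id_comp, hip]
  exact hid (himp ▸ I.comp_mem i p hm)

end CategoryIdeal

/-! ### The maximal ideal of the category of modules of finite `F`-rank -/

section FiniteFRank

variable {S : Type u} [Ring S] {F : ModuleCat.{v} S}

theorem CategoryTheory.Indecomposable.eq_bot_or_eq_bot_of_isCompl (hF : Indecomposable F)
    (C D : Submodule S F) (h : IsCompl C D) : C = ⊥ ∨ D = ⊥ := by
  refine (hF.2 (.of S C) (.of S D) ((C.prodEquivOfIsCompl D h).symm.toModuleIso ≪≫
    (ModuleCat.biprodIsoProd (.of S C) (.of S D)).symm)).imp (fun h => ?_) (fun h => ?_)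
  · have : Subsingleton C := ModuleCat.isZero_of_iff_subsingleton.1 h
    exact Submodule.subsingleton_iff_eq_bot.1 this
  · have : Subsingleton D := ModuleCat.isZero_of_iff_subsingleton.1 h
    exact Submodule.subsingleton_iff_eq_bot.1 this

theorem CategoryTheory.Indecomposable.nontrivial (hF : Indecomposable F) : Nontrivial F := by
  rw [← not_subsingleton_iff_nontrivial]
  exact fun h => hF.1 (ModuleCat.isZero_of_iff_subsingleton.2 h)

theorem finiteFRank_of_not_exists_retract {M : ModuleCat.{v} S}
    (h : ¬ ∃ (i : F →ₗ[S] M) (p : M →ₗ[S] F), p ∘ₗ i = LinearMap.id) : finiteFRank F M :=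
  ⟨0, Cardinal.aleph0_pos, hasFRank_zero h⟩

theorem finiteFRank_self [Nontrivial F] : finiteFRank F F :=
  ⟨1, Cardinal.one_lt_aleph0, hasFRank_self⟩

/-- An ideal of the category of modules of finite `F`-rank is the whole of `Hom` once it contains
the identity of `F` and the identities of the modules without direct summands isomorphic to `F`. -/
theorem CategoryIdeal.eq_top_of_id_mem_of_id_mem (hFF : finiteFRank F F)
    {J : CategoryIdeal (finiteFRank F).FullSubcategory}
    (hJ : 𝟙 (⟨F, hFF⟩ : (finiteFRank F).FullSubcategory) ∈ J.hom _ _)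
    (hJ' : ∀ X : (finiteFRank F).FullSubcategory,
      (¬ ∃ (i : F →ₗ[S] X.obj) (p : X.obj →ₗ[S] F), p ∘ₗ i = LinearMap.id) →
        𝟙 X ∈ J.hom X X) : J = ⊤ := by
  refine eq_top_of_id_mem fun X => ?_
  obtain ⟨κ, hκ, hX⟩ := X.property
  obtain ⟨Γ, _, f, g, N, p, hsum, hN⟩ := hX.exists_decomposition hκ
  let A : (finiteFRank F).FullSubcategory := ⟨F, hFF⟩
  let B : (finiteFRank F).FullSubcategory :=
    ⟨ModuleCat.of S N, finiteFRank_of_not_exists_retract hN⟩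
  let f' (γ : Γ) : X ⟶ A := ObjectProperty.homMk (ModuleCat.ofHom (f γ))
  let g' (γ : Γ) : A ⟶ X := ObjectProperty.homMk (ModuleCat.ofHom (g γ))
  let p' : X ⟶ B := ObjectProperty.homMk (ModuleCat.ofHom p)
  let i' : B ⟶ X := ObjectProperty.homMk (ModuleCat.ofHom N.subtype)
  have hid : 𝟙 X = (∑ γ, f' γ ≫ g' γ) + p' ≫ i' := by
    apply (finiteFRank F).ι.map_injective
    rw [Functor.map_add, Functor.map_sum]
    apply ModuleCat.hom_ext
    rw [ModuleCat.hom_add, ModuleCat.hom_sum]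
    exact hsum.symm
  rw [hid]
  exact add_mem (sum_mem fun γ _ => mem_of_id_mem hJ (f' γ) (g' γ))
    (mem_of_id_mem (hJ' B hN) p' i')

/-- A maximal ideal of the category of modules of finite `F`-rank does not contain the identity of
an indecomposable injective `F`: it does contain the identities of the modules without direct
summands isomorphic to `F`, whose powers have no such summands either. -/
theorem CategoryIdeal.id_notMem_of_isCoatom [Module.Injective S F] (hF : Indecomposable F)
    (hFF : finiteFRank F F) {J : CategoryIdeal (finiteFRank F).FullSubcategory}
    (hJ : IsCoatom J) : 𝟙 (⟨F, hFF⟩ : (finiteFRank F).FullSubcategory) ∉ J.hom _ _ := by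
  intro hid
  have := hF.nontrivial
  refine hJ.1 (eq_top_of_id_mem_of_id_mem hFF hid fun X hX => id_mem_of_isCoatom hJ X fun Γ => ?_)
  refine finiteFRank_of_not_exists_retract ?_
  rintro ⟨i, p, hip⟩
  exact hX (Module.Injective.exists_retract_of_finsupp hF.eq_bot_or_eq_bot_of_isCompl
    (Function.LeftInverse.injective (g := p) fun x => LinearMap.congr_fun hip x))

theorem CategoryTheory.Indecomposable.isLocalRing_end [Module.Injective S F]
    (hF : Indecomposable F) : IsLocalRing (End F) := by
  have := hF.nontrivial
  have := Module.Injective.isLocalRing_end hF.eq_bot_or_eq_bot_of_isCompl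
  have : IsLocalHom (ModuleCat.endRingEquiv F).toRingHom :=
    ⟨fun a h => (MulEquiv.isUnit_map (ModuleCat.endRingEquiv F)).1 h⟩
  exact RingHom.domain_isLocalRing (ModuleCat.endRingEquiv F).toRingHom

variable [IsLocalRing (End F)]

/-- An ideal not contained in the one associated to the nonunits of `End F` contains a morphism
through which an automorphism of `F` factors, and hence the identity of `F`. -/
theorem CategoryIdeal.id_mem_of_not_le (hFF : finiteFRank F F)
    {J : CategoryIdeal (finiteFRank F).FullSubcategory}
    (hJ : ¬ J ≤ (associated F (IsLocalRing.nonunitsIdeal (End F))).restrict (finiteFRank F)) :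
    𝟙 (⟨F, hFF⟩ : (finiteFRank F).FullSubcategory) ∈ J.hom _ _ := by
  obtain ⟨X, Y, f, hf, hfI⟩ : ∃ (X Y : (finiteFRank F).FullSubcategory) (f : X ⟶ Y),
      f ∈ J.hom X Y ∧ ¬ ∀ (α : F ⟶ X.obj) (β : Y.obj ⟶ F),
        (show End F from α ≫ f.hom ≫ β) ∈ IsLocalRing.nonunitsIdeal (End F) := by
    by_contra! h
    exact hJ fun X Y f hf => h X Y f hf
  push Not at hfI
  obtain ⟨α, β, hu⟩ := hfI
  rw [IsLocalRing.mem_nonunitsIdeal, not_not] at hu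
  obtain ⟨b, hb⟩ := hu.exists_left_inv
  let A : (finiteFRank F).FullSubcategory := ⟨F, hFF⟩
  let α' : A ⟶ X := ObjectProperty.homMk α
  let β' : Y ⟶ A := ObjectProperty.homMk (β ≫ b)
  have h : α' ≫ f ≫ β' = 𝟙 A := by
    apply (finiteFRank F).ι.map_injective
    change α ≫ f.hom ≫ β ≫ b = 𝟙 F
    rw [← Category.assoc f.hom, ← Category.assoc α]
    exact hb
  exact h ▸ J.comp_mem α' β' hf

theorem CategoryIdeal.restrict_associated_ne_top (hFF : finiteFRank F F) :
    (associated F (IsLocalRing.nonunitsIdeal (End F))).restrict (finiteFRank F) ≠ ⊤ := by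
  intro h
  have hid : 𝟙 (⟨F, hFF⟩ : (finiteFRank F).FullSubcategory) ∈
      ((associated F (IsLocalRing.nonunitsIdeal (End F))).restrict (finiteFRank F)).hom _ _ := by
    rw [h]
    exact AddSubgroup.mem_top _
  refine IsLocalRing.mem_nonunitsIdeal.1 (hid (𝟙 F) (𝟙 F)) ?_
  have h1 : (show End F from 𝟙 F ≫ 𝟙 F ≫ 𝟙 F) = 1 := by simp
  exact h1 ▸ isUnit_one

theorem CategoryIdeal.isCoatom_restrict_associated (hFF : finiteFRank F F) :
    IsCoatom ((associated F (IsLocalRing.nonunitsIdeal (End F))).restrict (finiteFRank F)) := by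
  refine ⟨restrict_associated_ne_top hFF, fun J hJ => ?_⟩
  refine eq_top_of_id_mem_of_id_mem hFF (id_mem_of_not_le hFF hJ.not_ge) fun X hX => ?_
  refine hJ.le X X fun α β => IsLocalRing.mem_nonunitsIdeal.2 fun hu => hX ?_
  obtain ⟨b, hb⟩ := hu.exists_left_inv
  exact ⟨α.hom, b.hom ∘ₗ β.hom, congrArg ModuleCat.Hom.hom hb⟩

end FiniteFRank

theorem mainTheorem6 {R : Type u} [Ring R] [Small.{v} R] [IsNoetherianRing Rᵐᵒᵖ]
    (F : ModuleCat.{v} Rᵐᵒᵖ) (hF : Injective F) (hF' : Indecomposable F) :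
    (∃! I : TwoSidedIdeal (End F), IsCoatom I) ∧
    ∀ I : TwoSidedIdeal (End F), IsCoatom I →
      IsCoatom ((CategoryIdeal.associated F I).restrict (finiteFRank F)) ∧
      ∀ M : CategoryIdeal (finiteFRank F).FullSubcategory, IsCoatom M →
        M = (CategoryIdeal.associated F I).restrict (finiteFRank F) := by
  have : Injective (ModuleCat.of Rᵐᵒᵖ F) := hF
  have : Module.Injective Rᵐᵒᵖ F := Module.injective_module_of_injective_object Rᵐᵒᵖ F
  have := hF'.isLocalRing_end
  have := hF'.nontrivial
  have hFF : finiteFRank F F := finiteFRank_self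
  simp only [IsLocalRing.isCoatom_twoSidedIdeal_iff, existsUnique_eq, forall_eq, true_and]
  refine ⟨CategoryIdeal.isCoatom_restrict_associated hFF, fun M hM => ?_⟩
  -- A maximal ideal contained in a proper ideal is equal to it.
  have hle : M ≤ (CategoryIdeal.associated F
      (IsLocalRing.nonunitsIdeal (End F))).restrict (finiteFRank F) := by
    by_contra h
    exact CategoryIdeal.id_notMem_of_isCoatom hF' hFF hM (CategoryIdeal.id_mem_of_not_le hFF h)
  exact ((hM.le_iff_eq (CategoryIdeal.restrict_associated_ne_top hFF)).1 hle).symm
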